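/- Let $I$ be a finite set and $M=(m_{ij})_{i,j\in I}$ a Coxeter matrix with $m_{ij}\in\{2,\infty\}$ for all $i\neq j$. Let $\Delta$ be a building of type $M$, viewed as a (non-empty) chamber system, that is semiregular: for each $i\in I$ all $i$-panels have the same (possibly infinite) cardinality $q_i\ge 2$. For each $i\in I$ let $X_i$ be a set with $|X_i|=q_i$, and let $\lambda=(\lambda_i)_{i\in I}\colon\Delta\to\prod_{i\in I}X_i$ be a legal colouring: for every $i$-panel $\mathcal P$, the restriction $\lambda_i|_{\mathcal P}\colon\mathcal P\to X_i$ is a bijection and $\lambda_j|_{\mathcal P}$ is constant for each $j\ne i$. For a type-preserving automorphism $g\in\operatorname{Aut}(\Delta)$ and an $i$-panel $\mathcal P$, put $\sigma_\lambda(g,\mathcal P)=\lambda_i|_{g\mathcal P}\circ g|_{\mathcal P}\circ(\lambda_i|_{\mathcal P})^{-1}\in\operatorname{Sym}(X_i)$. Given permutation groups $F_i\le\operatorname{Sym}(X_i)$ $(i\in I)$, not necessarily transitive or of finite degree, let $$U(\boldsymbol F)=\{g\in\operatorname{Aut}(\Delta)\mid \sigma_\lambda(g,\mathcal P)\in F_i\text{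 for every }i\in I\text{ and every }i\text{-panel }\mathcal P\}.$$ All permutation groups carry the permutation topology, in which the pointwise stabilisers of finite sets form a neighbourhood basis of the identity; here $U(\boldsymbol F)$ acts on the set of chambers of $\Delta$. Assume that every $F_i$ is closed in $\operatorname{Sym}(X_i)$, and consider the conditions (i) every point stabiliser in every $F_i$ is compact; (ii) every chamber stabiliser in $U(\boldsymbol F)$ is compact; (iii) $U(\boldsymbol F)$ is a locally compact topological group. If the diagram of $\Delta$ has no isolated nodes (for every $i\in I$ there is $j\in I$ with $m_{ij}=\infty$), then (i), (ii) and (iii) are equivalent. Without this assumption on the diagram, (i) and (ii) are still equivalent, and they imply (iii). -/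

import Mathlib

universe u v w

/-! ### The permutation topology -/

/-- The permutation topology on `Sym(Y)`: the topology of pointwise convergence, where `Y` is
discrete. Subgroups of `Sym(Y)` carry the subspace topology. -/
instance permTopology (Y : Type u) : TopologicalSpace (Equiv.Perm Y) :=
  TopologicalSpace.induced (fun g : Equiv.Perm Y => (g : Y → Y))
    (@Pi.topologicalSpace Y (fun _ => Y) (fun _ => ⊥))

/-- A neighbourhood basis of `g` is given by the cosets of the pointwise stabilisers of the
finite subsets of `Y`. -/
theorem permTopology_hasBasis_nhds {Y : Type u} (g : Equiv.Perm Y) :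
    (nhds g).HasBasis (fun s : Set Y => s.Finite) (fun s => {h | ∀ y ∈ s, h y = g y}) := by
  let tY : TopologicalSpace Y := ⊥
  have hd : DiscreteTopology Y := ⟨rfl⟩
  refine ⟨fun t => ?_⟩
  have h1 : nhds g = Filter.comap (fun k : Equiv.Perm Y => (k : Y → Y)) (nhds (g : Y → Y)) :=
    nhds_induced _ _
  rw [h1, Filter.mem_comap]
  constructor
  · rintro ⟨T, hT, hsub⟩
    rw [nhds_pi, Filter.mem_pi] at hT
    obtain ⟨s, hs, V, hV, hsV⟩ := hT
    refine ⟨s, hs, fun k hk => hsub (hsV fun y hy => ?_)⟩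
    change k y ∈ V y
    rw [show k y = g y from hk y hy]
    exact mem_of_mem_nhds (hV y)
  · rintro ⟨s, hs, hsub⟩
    refine ⟨s.pi fun y => {g y}, set_pi_mem_nhds hs fun y _ => by simp, fun k hk => hsub ?_⟩
    exact fun y hy => hk y hy

/-- With the permutation topology, `Sym(Y)` (hence each of its subgroups) is a topological
group. -/
instance permTopology_isTopologicalGroup (Y : Type u) :
    IsTopologicalGroup (Equiv.Perm Y) where
  continuous_mul := by
    rw [continuous_iff_continuousAt]
    rintro ⟨g, h⟩
    have hb := (permTopology_hasBasis_nhds g).prod_nhds (permTopology_hasBasis_nhds h)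
    refine (hb.tendsto_iff (permTopology_hasBasis_nhds (g * h))).2 fun s hs => ?_
    refine ⟨(h '' s, s), ⟨hs.image h, hs⟩, ?_⟩
    rintro ⟨a, b⟩ ⟨ha, hb'⟩ y hy
    change a (b y) = g (h y)
    rw [show b y = h y from hb' y hy]
    exact ha _ ⟨y, hy, rfl⟩
  continuous_inv := by
    rw [continuous_iff_continuousAt]
    intro g
    refine ((permTopology_hasBasis_nhds g).tendsto_iff
      (permTopology_hasBasis_nhds g⁻¹)).2 fun s hs => ?_
    refine ⟨(fun y => g⁻¹ y) '' s, hs.image _, ?_⟩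
    intro a ha y hy
    have h1 : a (g⁻¹ y) = y := (ha _ ⟨y, hy, rfl⟩).trans (g.apply_symm_apply y)
    exact Equiv.Perm.inv_eq_iff_eq.2 h1.symm

/-! ### Chamber systems and buildings -/

/-- A chamber system over `I` with set of chambers `C`: for every `i`, an equivalence relation
on `C`, called `i`-adjacency. -/
structure ChamberSystem (I : Type u) (C : Type v) where
  adj : I → Setoid C

namespace ChamberSystem

variable {I : Type u} {C : Type v}

/-- `Δ.IsGallery c ω d`: there is a gallery of type `ω` from `c` to `d`, that is, a sequence of
chambers in which consecutive chambers are distinct and adjacent, with adjacency types `ω`. -/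
inductive IsGallery (Δ : ChamberSystem I C) : C → List I → C → Prop
  | nil (c : C) : IsGallery Δ c [] c
  | cons {c d e : C} {i : I} {ω : List I} :
      (Δ.adj i) c d → c ≠ d → IsGallery Δ d ω e → IsGallery Δ c (i :: ω) e

/-- The `i`-panel containing the chamber `c`. -/
def panel (Δ : ChamberSystem I C) (i : I) (c : C) : Set C := {d | (Δ.adj i) c d}

/-- `Δ` is a building of type `M` (an entry `0` of a `CoxeterMatrix` stands for `∞`): it is
non-empty, every panel has at least two chambers, and there is a distance function `δ` with
values in the Coxeter group such that, for each reduced word `ω`, there is a gallery of type `ω`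
from `c` to `d` if and only if `δ c d` is the element represented by `ω`. -/
def IsBuilding (Δ : ChamberSystem I C) (M : CoxeterMatrix I) : Prop :=
  Nonempty C ∧ (∀ (i : I) (c : C), ∃ d ∈ Δ.panel i c, d ≠ c) ∧
    ∃ δ : C → C → M.Group, ∀ (c d : C) (ω : List I), M.toCoxeterSystem.IsReduced ω →
      (δ c d = M.toCoxeterSystem.wordProd ω ↔ Δ.IsGallery c ω d)

/-- `Δ` is semiregular with parameters `q_i = |X_i| ≥ 2`: all `i`-panels have the cardinality
of `X i`. -/
def IsSemiregular (Δ : ChamberSystem I C) (X : I → Type w) : Prop :=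
  ∀ i, Nontrivial (X i) ∧ ∀ c : C, Nonempty (Δ.panel i c ≃ X i)

/-- The group of type-preserving automorphisms, as a group of permutations of the chambers. -/
def Aut (Δ : ChamberSystem I C) : Subgroup (Equiv.Perm C) where
  carrier := {g | ∀ (i : I) (c d : C), (Δ.adj i) (g c) (g d) ↔ (Δ.adj i) c d}
  one_mem' := fun _ _ _ => Iff.rfl
  mul_mem' := fun {g h} hg hh i c d => (hg i (h c) (h d)).trans (hh i c d)
  inv_mem' := fun {g} hg i c d => by
    simpa using (hg i (g⁻¹ c) (g⁻¹ d)).symm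

/-- A legal colouring of `Δ` with sets of colours `X i`: for every `i`-panel, the `i`-colour
restricts to a bijection onto `X i`, and the `j`-colour is constant for `j ≠ i`. -/
structure LegalColouring (Δ : ChamberSystem I C) (X : I → Type w) where
  colour : C → (i : I) → X i
  bijective : ∀ (i : I) (c : C), Function.Bijective (fun d : Δ.panel i c => colour d.1 i)
  constant : ∀ (i j : I), j ≠ i → ∀ c : C, ∀ d ∈ Δ.panel i c, colour d j = colour c j

variable {Δ : ChamberSystem I C} {X : I → Type w}

/-- The bijection `λ_i|_P : P → X_i` for the `i`-panel `P` of `c`. -/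
noncomputable def LegalColouring.panelEquiv (lam : Δ.LegalColouring X) (i : I) (c : C) :
    Δ.panel i c ≃ X i :=
  Equiv.ofBijective _ (lam.bijective i c)

/-- The bijection `g|_P : P → gP` for the `i`-panel `P` of `c`. -/
def panelMap (g : Δ.Aut) (i : I) (c : C) : Δ.panel i c ≃ Δ.panel i (g.1 c) :=
  g.1.subtypeEquiv fun d => (g.2 i c d).symm

/-- The local action `σ(g, P) = λ_i|_{gP} ∘ g|_P ∘ (λ_i|_P)⁻¹` of `g` at the `i`-panel `P`
of `c`. -/
noncomputable def LegalColouring.localAction (lam : Δ.LegalColouring X) (g : Δ.Aut) (i : I)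
    (c : C) : Equiv.Perm (X i) :=
  (lam.panelEquiv i c).symm.trans ((panelMap g i c).trans (lam.panelEquiv i (g.1 c)))

theorem LegalColouring.localAction_colour (lam : Δ.LegalColouring X) (g : Δ.Aut) (i : I)
    (c d : C) (hd : d ∈ Δ.panel i c) :
    lam.localAction g i c (lam.colour d i) = lam.colour (g.1 d) i := by
  have h : (lam.panelEquiv i c).symm (lam.colour d i) = ⟨d, hd⟩ :=
    (lam.panelEquiv i c).symm_apply_apply ⟨d, hd⟩
  simp only [LegalColouring.localAction, Equiv.trans_apply, h]
  rfl

theorem LegalColouring.localAction_eq_of_colour (lam : Δ.LegalColouring X) (g : Δ.Aut) (i : I)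
    (c : C) (f : Equiv.Perm (X i))
    (hf : ∀ d ∈ Δ.panel i c, f (lam.colour d i) = lam.colour (g.1 d) i) :
    lam.localAction g i c = f := by
  ext x
  obtain ⟨⟨d, hd⟩, rfl⟩ := (lam.bijective i c).2 x
  exact (lam.localAction_colour g i c d hd).trans (hf d hd).symm

theorem LegalColouring.localAction_mul (lam : Δ.LegalColouring X) (g h : Δ.Aut) (i : I)
    (c : C) :
    lam.localAction (g * h) i c = lam.localAction g i (h.1 c) * lam.localAction h i c := by
  refine lam.localAction_eq_of_colour _ i c _ fun d hd => ?_
  rw [Equiv.Perm.mul_apply, lam.localAction_colour h i c d hd,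
    lam.localAction_colour g i (h.1 c) (h.1 d) ((h.2 i c d).2 hd)]
  rfl

theorem LegalColouring.localAction_one (lam : Δ.LegalColouring X) (i : I) (c : C) :
    lam.localAction (1 : Δ.Aut) i c = 1 :=
  lam.localAction_eq_of_colour _ i c _ fun _ _ => rfl

/-- The universal group `U(F)`: the automorphisms of `Δ` all of whose local actions, at all
`i`-panels for all `i`, lie in `F i`. -/
def universalGroup (lam : Δ.LegalColouring X) (F : (i : I) → Subgroup (Equiv.Perm (X i))) :
    Subgroup Δ.Aut where
  carrier := {g | ∀ (i : I) (c : C), lam.localAction g i c ∈ F i}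
  one_mem' := fun i c => by
    rw [lam.localAction_one]
    exact (F i).one_mem
  mul_mem' := fun {g h} hg hh i c => by
    rw [lam.localAction_mul]
    exact (F i).mul_mem (hg i _) (hh i c)
  inv_mem' := fun {g} hg i c => by
    have h := lam.localAction_mul g g⁻¹ i c
    rw [mul_inv_cancel, lam.localAction_one] at h
    rw [← inv_eq_of_mul_eq_one_right h.symm]
    exact (F i).inv_mem (hg i _)

end ChamberSystem

/-- The Coxeter diagram is right-angled: `m_ij ∈ {2, ∞}` for distinct `i` and `j`. -/
def CoxeterMatrix.IsRightAngled {I : Type u} (M : CoxeterMatrix I) : Prop :=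
  ∀ i j : I, i ≠ j → M i j = 2 ∨ M i j = 0

/-- The Coxeter diagram has no isolated nodes: each `i` is joined to some `j ≠ i`, that is,
`m_ij ≠ 2`. -/
def CoxeterMatrix.NoIsolatedNodes {I : Type u} (M : CoxeterMatrix I) : Prop :=
  ∀ i : I, ∃ j : I, j ≠ i ∧ M i j ≠ 2

/-!
A map from a right-angled building to another chamber system with prescribed colours is a section
of their fibre product over the colours. This fibre product covers the building, and in it every
gallery can be replaced by one of reduced type; as a gallery of reduced type in a building is not
closed, every component of the covering is mapped bijectively to the building, and the section
exists. In particular, two legal colourings which agree at a chamber differ by an automorphism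
fixing this chamber.

For `f ∈ F i` with `f x = x`, twisting the `i`-colours of all chambers by `f` therefore gives an
element of `U(F)` which fixes a given chamber of `i`-colour `x` and acts locally as `f`. So the
stabiliser of `x` in `F i` is a closed subset of a continuous image of a chamber stabiliser.
Conversely, chamber stabilisers are closed in `Sym(C)` and have finite orbits if the point
stabilisers of all `F i` are compact.

If `m_ij = ∞`, then mapping the building to the bi-infinite sequence of alternately `i`- and
`j`-adjacent chambers yields an unbounded height which changes only on `i`-panels, and there only
between the colour `x` and the other colours. Twisting by `f` only above a certain height still
gives an element of `U(F)`, which now fixes any given finite set of chambers. So the compact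
neighbourhoods of the identity also detect the stabiliser of `x`.
-/

/-! ### Compactness in the permutation topology -/

section PermutationTopology

open Equiv MulAction Topology

variable {Y : Type*}

theorem permTopology_isEmbedding_coe [TopologicalSpace Y] [DiscreteTopology Y] :
    IsEmbedding fun g : Perm Y => (g : Y → Y) where
  eq_induced := by rw [DiscreteTopology.eq_bot (α := Y)]; rfl
  injective := DFunLike.coe_injective

theorem permTopology_continuous_coe [TopologicalSpace Y] [DiscreteTopology Y] :
    Continuous fun g : Perm Y => (g : Y → Y) :=
  permTopology_isEmbedding_coe.continuous

instance permTopology_t2Space : T2Space (Perm Y) := by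
  let _ : TopologicalSpace Y := ⊥
  have : DiscreteTopology Y := ⟨rfl⟩
  exact permTopology_isEmbedding_coe.t2Space

theorem permTopology_isClopen_setOf_apply₂ (p : Y → Y → Prop) (y z : Y) :
    IsClopen {g : Perm Y | p (g y) (g z)} := by
  let _ : TopologicalSpace Y := ⊥
  have : DiscreteTopology Y := ⟨rfl⟩
  have hcont : Continuous fun g : Perm Y => (g y, g z) :=
    ((continuous_apply y).comp permTopology_continuous_coe).prodMk
      ((continuous_apply z).comp permTopology_continuous_coe)
  exact (isClopen_discrete {q : Y × Y | p q.1 q.2}).preimage hcont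

theorem permTopology_continuous {T : Type*} [TopologicalSpace T] {f : T → Perm Y}
    (hf : ∀ y z, IsOpen {t | f t y = z}) : Continuous f := by
  let _ : TopologicalSpace Y := ⊥
  have : DiscreteTopology Y := ⟨rfl⟩
  exact permTopology_isEmbedding_coe.continuous_iff.2 <|
    continuous_pi fun y => continuous_discrete_rng.2 fun z => hf y z

theorem permTopology_isClosedEmbedding_coe_prodMk_inv [TopologicalSpace Y]
    [DiscreteTopology Y] :
    IsClosedEmbedding fun g : Perm Y => ((g : Y → Y), (⇑g⁻¹ : Y → Y)) := by
  have hinv : Continuous fun g : Perm Y => (⇑g⁻¹ : Y → Y) :=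
    permTopology_continuous_coe.comp continuous_inv
  refine ⟨.of_comp (permTopology_continuous_coe.prodMk hinv) continuous_fst
    permTopology_isEmbedding_coe, ?_⟩
  have hrange : Set.range (fun g : Perm Y => ((g : Y → Y), (⇑g⁻¹ : Y → Y))) =
      ⋂ (y : Y) (z : Y), {q : (Y → Y) × (Y → Y) | q.1 y = z ↔ q.2 z = y} := by
    ext q
    simp only [Set.mem_range, Set.mem_iInter, Set.mem_ofPred_eq]
    constructor
    · rintro ⟨g, rfl⟩ y z
      exact eq_comm.trans Perm.inv_eq_iff_eq.symm
    · exact fun hq => ⟨⟨q.1, q.2, fun y => (hq y _).1 rfl, fun z => (hq _ z).2 rfl⟩, rfl⟩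
  rw [hrange]
  refine isClosed_iInter fun y => isClosed_iInter fun z => ?_
  have hcont : Continuous fun q : (Y → Y) × (Y → Y) => (q.1 y, q.2 z) := by fun_prop
  exact (isClosed_discrete {r : Y × Y | r.1 = z ↔ r.2 = y}).preimage hcont

theorem permTopology_isCompact_of_finite {A : Set (Perm Y)} (hA : IsClosed A)
    (hfin : ∀ y, ((fun g : Perm Y => g y) '' A).Finite)
    (hfin' : ∀ y, ((fun g : Perm Y => g⁻¹ y) '' A).Finite) : IsCompact A := by
  let _ : TopologicalSpace Y := ⊥
  have : DiscreteTopology Y := ⟨rfl⟩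
  have hbox : IsCompact
      (Set.univ.pi (fun y => (fun g : Perm Y => g y) '' A) ×ˢ
        Set.univ.pi (fun y => (fun g : Perm Y => g⁻¹ y) '' A)) :=
    (isCompact_univ_pi fun y => (hfin y).isCompact).prod
      (isCompact_univ_pi fun y => (hfin' y).isCompact)
  refine (permTopology_isClosedEmbedding_coe_prodMk_inv.isCompact_preimage hbox).of_isClosed_subset
    hA fun g hg => ?_
  exact ⟨fun y _ => Set.mem_image_of_mem _ hg, fun y _ => Set.mem_image_of_mem _ hg⟩

theorem isClosed_of_isCompact_stabilizer {H : Subgroup (Perm Y)} {y : Y}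
    (hcomp : IsCompact (stabilizer H y : Set H)) : IsClosed (H : Set (Perm Y)) := by
  refine isClosed_of_closure_subset fun g hg => ?_
  let U : Set (Perm Y) := {k | k y = g y}
  have hU : IsOpen U := (permTopology_isClopen_setOf_apply₂ (fun z _ => z = g y) y y).isOpen
  obtain ⟨f, hfy : f y = g y, hf : f ∈ H⟩ := mem_closure_iff.1 hg U hU rfl
  let K : Set (Perm Y) := (fun k : H => f * k) '' stabilizer H y
  have hK : IsClosed K := (hcomp.image (by fun_prop)).isClosed
  have hUH : U ∩ H ⊆ K := by
    rintro k ⟨hky : k y = g y, hk⟩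
    refine ⟨⟨f⁻¹ * k, H.mul_mem (H.inv_mem hf) hk⟩, ?_, mul_inv_cancel_left f k⟩
    exact Perm.inv_eq_iff_eq.2 (hky.trans hfy.symm)
  obtain ⟨k, -, rfl⟩ := closure_minimal hUH hK (hU.inter_closure ⟨rfl, hg⟩)
  exact H.mul_mem hf k.2

variable {G : Type*} [Group G] [MulAction G Y]

theorem finite_orbit_stabilizer_trans {c d e : Y} (hcd : (orbit (stabilizer G c) d).Finite)
    (hde : (orbit (stabilizer G d) e).Finite) : (orbit (stabilizer G c) e).Finite := by
  choose! k hk using fun (d' : Y) (h : d' ∈ orbit (stabilizer G c) d) => h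
  have hcover : orbit (stabilizer G c) e ⊆
      ⋃ d' ∈ orbit (stabilizer G c) d, (k d' • ·) '' orbit (stabilizer G d) e := by
    rintro _ ⟨g, rfl⟩
    have hgd : k (g • d) • d = g • d := hk _ ⟨g, rfl⟩
    have hstab : (k (g • d) : G)⁻¹ * g ∈ stabilizer G d := by
      rw [mem_stabilizer_iff, mul_smul, inv_smul_eq_iff]
      exact hgd.symm
    refine Set.mem_biUnion (Set.mem_range_self g) ⟨_, ⟨⟨_, hstab⟩, rfl⟩, ?_⟩
    exact (smul_smul (k (g • d) : G) _ e).trans (by rw [mul_inv_cancel_left]; rfl)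
  exact (hcd.biUnion fun d' _ => hde.image _).subset hcover

variable [TopologicalSpace G]

theorem isClopen_stabilizer (hG : Continuous (toPermHom G Y)) (y : Y) :
    IsClopen (stabilizer G y : Set G) :=
  (permTopology_isClopen_setOf_apply₂ (fun z _ => z = y) y y).preimage hG

theorem finite_orbit_of_isCompact (hG : Continuous (toPermHom G Y)) {K : Subgroup G}
    (hK : IsCompact (K : Set G)) (y : Y) : (orbit K y).Finite := by
  let _ : TopologicalSpace Y := ⊥
  have : DiscreteTopology Y := ⟨rfl⟩
  have hcont : Continuous fun g : G => g • y :=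
    (continuous_apply y).comp (permTopology_continuous_coe.comp hG)
  refine (hK.image hcont).finite_of_discrete.subset ?_
  rintro _ ⟨g, rfl⟩
  exact ⟨g, g.2, rfl⟩

theorem isCompact_of_finite_orbits (hG : IsClosedEmbedding (toPermHom G Y)) {K : Subgroup G}
    (hK : IsClosed (K : Set G)) (hfin : ∀ y : Y, (orbit K y).Finite) : IsCompact (K : Set G) := by
  rw [hG.isEmbedding.isInducing.isCompact_iff]
  refine permTopology_isCompact_of_finite (hG.isClosedMap _ hK) (fun y => (hfin y).subset ?_)
    fun y => (hfin y).subset ?_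
  · rintro _ ⟨_, ⟨g, hg, rfl⟩, rfl⟩
    exact ⟨⟨g, hg⟩, rfl⟩
  · rintro _ ⟨_, ⟨g, hg, rfl⟩, rfl⟩
    exact ⟨⟨g⁻¹, K.inv_mem hg⟩, rfl⟩

theorem exists_finite_isCompact_fixingSubgroup [LocallyCompactSpace G]
    (hG : IsInducing (toPermHom G Y)) :
    ∃ S : Set Y, S.Finite ∧ IsCompact (fixingSubgroup G S : Set G) := by
  obtain ⟨K, hK, hK1⟩ := exists_compact_mem_nhds (1 : G)
  have hbasis := hG.basis_nhds (x := 1) (permTopology_hasBasis_nhds _)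
  obtain ⟨S, hS, hSK⟩ := hbasis.mem_iff.1 hK1
  refine ⟨S, hS, hK.of_isClosed_subset ?_ fun g hg => hSK fun y hy => ?_⟩
  · have hinter : (fixingSubgroup G S : Set G) = ⋂ y ∈ S, (stabilizer G y : Set G) := by
      ext g
      simp [mem_fixingSubgroup_iff]
    rw [hinter]
    exact isClosed_biInter fun y _ => (isClopen_stabilizer hG.continuous y).isClosed
  · rw [map_one]
    exact (mem_fixingSubgroup_iff G).1 hg y hy

theorem locallyCompactSpace_of_isCompact_stabilizer [IsTopologicalGroup G]
    (hG : Continuous (toPermHom G Y)) {y : Y}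
    (hcomp : IsCompact (stabilizer G y : Set G)) : LocallyCompactSpace G :=
  hcomp.locallyCompactSpace_of_mem_nhds_of_group
    ((isClopen_stabilizer hG y).isOpen.mem_nhds (one_mem (stabilizer G y)))

end PermutationTopology

/-! ### Right-angled Coxeter groups -/

namespace RightAngledCoxeter

variable {I : Type*} {M : CoxeterMatrix I}

/-- The letter `s` occurs in the word `ω` and commutes with every letter before that occurrence,
so that it can be moved to the front of `ω`. -/
def IsInitialLetter (M : CoxeterMatrix I) (s : I) (ω : List I) : Prop :=
  ∃ u b, ω = u ++ s :: b ∧ ∀ t ∈ u, M s t = 2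

theorem isInitialLetter_cons_self (s : I) (ω : List I) : IsInitialLetter M s (s :: ω) :=
  ⟨[], ω, rfl, by simp⟩

theorem IsInitialLetter.cons {s t : I} {ω : List I} (h : IsInitialLetter M s ω)
    (hst : M s t = 2) : IsInitialLetter M s (t :: ω) := by
  obtain ⟨u, b, rfl, hu⟩ := h
  exact ⟨t :: u, b, rfl, List.forall_mem_cons.2 ⟨hst, hu⟩⟩

theorem ne_of_eq_two {s t : I} (h : M s t = 2) : s ≠ t := by
  rintro rfl
  simp at h

theorem ne_of_eq_zero {s t : I} (h : M s t = 0) : s ≠ t := by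
  rintro rfl
  simp at h

theorem commute_simple_of_eq_two {s t : I} (h : M s t = 2) :
    Commute (M.toCoxeterSystem.simple s) (M.toCoxeterSystem.simple t) := by
  have hsq := M.toCoxeterSystem.simple_mul_simple_pow s t
  rw [h, pow_two] at hsq
  rw [Commute, SemiconjBy, eq_inv_of_mul_eq_one_left hsq, mul_inv_rev,
    CoxeterSystem.inv_simple, CoxeterSystem.inv_simple]

theorem wordProd_append_cons_of_commute {s : I} {u : List I} (hu : ∀ t ∈ u, M s t = 2)
    (b : List I) :
    M.toCoxeterSystem.wordProd (u ++ s :: b) = M.toCoxeterSystem.wordProd (s :: (u ++ b)) := by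
  induction u with
  | nil => rfl
  | cons t u ih =>
    obtain ⟨ht, hu⟩ := List.forall_mem_cons.1 hu
    have ih := ih hu
    simp only [List.cons_append, CoxeterSystem.wordProd_cons] at ih ⊢
    rw [ih, (commute_simple_of_eq_two ht).symm.left_comm]

theorem IsInitialLetter.not_isReduced_cons {s : I} {ω : List I} (h : IsInitialLetter M s ω) :
    ¬ M.toCoxeterSystem.IsReduced (s :: ω) := by
  obtain ⟨u, b, rfl, hu⟩ := h
  intro hred
  have hcancel : M.toCoxeterSystem.wordProd (s :: (u ++ s :: b)) =
      M.toCoxeterSystem.wordProd (u ++ b) := by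
    rw [CoxeterSystem.wordProd_cons, wordProd_append_cons_of_commute hu,
      CoxeterSystem.wordProd_cons, CoxeterSystem.simple_mul_simple_cancel_left]
  have hle := M.toCoxeterSystem.length_wordProd_le (u ++ b)
  rw [← hcancel, hred.eq] at hle
  simp at hle

open Classical in
/-- The dual of the geometric action of the generator `s` of a right-angled Coxeter group, on
integer-valued functions on the set of simple roots. It is an element of `Function.End` because
representations of a Coxeter group are defined by lifting to a monoid. -/
noncomputable def dualReflection (M : CoxeterMatrix I) (s : I) : Function.End (I → ℤ) :=
  fun f t => if t = s then -f s else if M s t = 0 then f t + 2 * f s else f t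

theorem dualReflection_self (s : I) (f : I → ℤ) : dualReflection M s f s = -f s :=
  if_pos rfl

theorem dualReflection_of_eq_zero {s t : I} (h : M s t = 0) (f : I → ℤ) :
    dualReflection M s f t = f t + 2 * f s := by
  simp [dualReflection, h, (ne_of_eq_zero h).symm]

theorem dualReflection_of_eq_two {s t : I} (h : M s t = 2) (f : I → ℤ) :
    dualReflection M s f t = f t := by
  simp [dualReflection, h, (ne_of_eq_two h).symm]

theorem dualReflection_dualReflection (hM : M.IsRightAngled) (s : I) (f : I → ℤ) :
    dualReflection M s (dualReflection M s f) = f := by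
  funext t
  rcases eq_or_ne s t with rfl | hst
  · rw [dualReflection_self, dualReflection_self, neg_neg]
  rcases hM s t hst with h | h
  · rw [dualReflection_of_eq_two h, dualReflection_of_eq_two h]
  · rw [dualReflection_of_eq_zero h, dualReflection_of_eq_zero h, dualReflection_self]
    ring

theorem dualReflection_comm {s t : I} (h : M s t = 2) (f : I → ℤ) :
    dualReflection M s (dualReflection M t f) = dualReflection M t (dualReflection M s f) := by
  have hts : M t s = 2 := by rwa [M.symmetric]
  have hne : t ≠ s := (ne_of_eq_two h).symm
  funext r
  simp only [dualReflection]
  grind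

theorem isLiftable_dualReflection (hM : M.IsRightAngled) : M.IsLiftable (dualReflection M) := by
  intro s t
  rcases eq_or_ne s t with rfl | hst
  · rw [M.diagonal, pow_one]
    exact funext (dualReflection_dualReflection hM s)
  rcases hM s t hst with h | h
  · rw [h, pow_two]
    funext f
    change dualReflection M s (dualReflection M t (dualReflection M s (dualReflection M t f))) = f
    rw [dualReflection_comm h f, dualReflection_dualReflection hM,
      dualReflection_dualReflection hM]
  · rw [h, pow_zero]

/-- The image under `w` of the vector of the dual geometric representation all of whose
coordinates are `1`. As this vector lies in the fundamental chamber, the coordinate at `s` is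
negative exactly when `s` is a left descent of `w`. -/
noncomputable def dualVector (hM : M.IsRightAngled) (w : M.Group) : I → ℤ :=
  M.toCoxeterSystem.lift ⟨dualReflection M, isLiftable_dualReflection hM⟩ w 1

theorem dualVector_simple_mul (hM : M.IsRightAngled) (s : I) (w : M.Group) :
    dualVector hM (M.toCoxeterSystem.simple s * w) = dualReflection M s (dualVector hM w) := by
  rw [dualVector, map_mul, M.toCoxeterSystem.lift_apply_simple (isLiftable_dualReflection hM)]
  rfl

theorem dualVector_one (hM : M.IsRightAngled) : dualVector hM 1 = 1 := by
  rw [dualVector, map_one]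
  rfl

theorem dualReflection_add_pos (hM : M.IsRightAngled) {v : I → ℤ}
    (hv : ∀ s t, M s t = 0 → 0 < v s + v t) {r : I} (hr : 0 < v r) {s t : I} (hst : M s t = 0) :
    0 < dualReflection M r v s + dualReflection M r v t := by
  have hle (k : I) (hk : k ≠ r) : v k ≤ dualReflection M r v k := by
    rcases hM r k hk.symm with h | h
    · rw [dualReflection_of_eq_two h]
    · rw [dualReflection_of_eq_zero h]
      lia
  have hpair (k : I) (hk : M r k = 0) :
      0 < dualReflection M r v r + dualReflection M r v k := by
    rw [dualReflection_self, dualReflection_of_eq_zero hk]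
    linarith [hv r k hk]
  rcases eq_or_ne s r with rfl | hs
  · exact hpair t hst
  rcases eq_or_ne t r with rfl | ht
  · rw [add_comm]
    exact hpair s (by rwa [M.symmetric])
  linarith [hv s t hst, hle s hs, hle t ht]

theorem dualVector_of_isReduced (hM : M.IsRightAngled) {ω : List I}
    (hω : M.toCoxeterSystem.IsReduced ω) :
    let v := dualVector hM (M.toCoxeterSystem.wordProd ω)
    (∀ s t, M s t = 0 → 0 < v s + v t) ∧ ∀ s, v s ≤ 0 → IsInitialLetter M s ω := by
  induction ω with
  | nil => simp [dualVector_one]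
  | cons r ω ih =>
    obtain ⟨hpos, hinit⟩ := ih (hω.drop 1)
    have hr : 0 < dualVector hM (M.toCoxeterSystem.wordProd ω) r := by
      by_contra hneg
      exact (hinit r (not_lt.1 hneg)).not_isReduced_cons hω
    simp only [CoxeterSystem.wordProd_cons, dualVector_simple_mul]
    refine ⟨fun s t => dualReflection_add_pos hM hpos hr, fun s hs => ?_⟩
    rcases eq_or_ne r s with rfl | hrs
    · exact isInitialLetter_cons_self r ω
    rcases hM r s hrs with h | h
    · rw [dualReflection_of_eq_two h] at hs
      exact (hinit s hs).cons (by rwa [M.symmetric])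
    · rw [dualReflection_of_eq_zero h] at hs
      linarith [hpos r s h]

theorem isInitialLetter_of_not_isReduced_cons (hM : M.IsRightAngled) {s : I} {ω : List I}
    (hω : M.toCoxeterSystem.IsReduced ω) (hsω : ¬ M.toCoxeterSystem.IsReduced (s :: ω)) :
    IsInitialLetter M s ω := by
  obtain ⟨ω', hω', heq⟩ :=
    M.toCoxeterSystem.exists_isReduced (M.toCoxeterSystem.wordProd (s :: ω))
  have hprod : M.toCoxeterSystem.wordProd ω = M.toCoxeterSystem.wordProd (s :: ω') := by
    rw [CoxeterSystem.wordProd_cons, ← heq, CoxeterSystem.wordProd_cons,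
      CoxeterSystem.simple_mul_simple_cancel_left]
  have hsω' : M.toCoxeterSystem.IsReduced (s :: ω') := by
    have hlen := M.toCoxeterSystem.length_simple_mul (M.toCoxeterSystem.wordProd ω) s
    rw [← CoxeterSystem.wordProd_cons, hω.eq] at hlen
    unfold CoxeterSystem.IsReduced
    rw [← hprod, hω.eq, List.length_cons, ← hω'.eq, ← heq, hlen.resolve_left hsω]
  have hpos : 0 < dualVector hM (M.toCoxeterSystem.wordProd ω') s := by
    by_contra hneg
    exact ((dualVector_of_isReduced hM hω').2 s (not_lt.1 hneg)).not_isReduced_cons hsω'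
  refine (dualVector_of_isReduced hM hω).2 s ?_
  rw [hprod, CoxeterSystem.wordProd_cons, dualVector_simple_mul, dualReflection_self]
  lia

theorem isReduced_pair (hM : M.IsRightAngled) {s t : I} (hst : s ≠ t) :
    M.toCoxeterSystem.IsReduced [s, t] := by
  have hsingle : M.toCoxeterSystem.IsReduced [t] := by
    rw [CoxeterSystem.IsReduced, CoxeterSystem.wordProd_singleton, CoxeterSystem.length_simple,
      List.length_singleton]
  by_contra hred
  obtain ⟨u, b, hub, -⟩ := isInitialLetter_of_not_isReduced_cons hM hsingle hred
  have hmem : s ∈ [t] := hub ▸ by simp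
  exact hst (List.mem_singleton.1 hmem)

end RightAngledCoxeter

namespace ChamberSystem

open RightAngledCoxeter

/-! ### Coverings of right-angled buildings -/

section Covering

variable {I C D Y : Type*} {M : CoxeterMatrix I} {Δ : ChamberSystem I C} {E : ChamberSystem I D}
  {Λ : ChamberSystem I Y}

/-- The conditions on residues of rank at most two which a chamber system shares with the
right-angled buildings: panels of distinct types meet in at most one chamber, and adjacencies of
commuting types can be interchanged. They are inherited by fibre products. -/
structure IsLocallyRightAngled (Δ : ChamberSystem I C) (M : CoxeterMatrix I) : Prop where
  eq_of_adj : ∀ {i j : I} {c d : C}, i ≠ j → (Δ.adj i) c d → (Δ.adj j) c d → c = d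
  exists_square : ∀ {i j : I} {c d e : C}, M i j = 2 → (Δ.adj i) c d → (Δ.adj j) d e →
    ∃ d', (Δ.adj j) c d' ∧ (Δ.adj i) d' e

/-- Two chambers are reachable from each other if they are joined by a sequence of chambers in
which consecutive chambers are adjacent, and possibly equal. -/
def Reachable (Δ : ChamberSystem I C) : C → C → Prop :=
  Relation.ReflTransGen fun c d => ∃ i, (Δ.adj i) c d

theorem Reachable.symm {c d : C} (h : Δ.Reachable c d) : Δ.Reachable d c := by
  induction h with
  | refl => exact .refl
  | tail _ hadj ih => exact .head ⟨_, (Δ.adj _).symm hadj.choose_spec⟩ ih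

theorem IsGallery.reachable {c d : C} {ω : List I} (h : Δ.IsGallery c ω d) :
    Δ.Reachable c d := by
  induction h with
  | nil => exact .refl
  | cons hadj _ _ ih => exact .head ⟨_, hadj⟩ ih

theorem IsLocallyRightAngled.isGallery_swap (hΔ : Δ.IsLocallyRightAngled M) {i j : I}
    (hij : M i j = 2) {ω : List I} {c e : C} (h : Δ.IsGallery c (i :: j :: ω) e) :
    Δ.IsGallery c (j :: i :: ω) e := by
  have hne : i ≠ j := ne_of_eq_two hij
  obtain _ | ⟨hi, hcd, _ | ⟨hj, hde, h⟩⟩ := h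
  obtain ⟨d', hj', hi'⟩ := hΔ.exists_square hij hi hj
  refine .cons hj' ?_ (.cons hi' ?_ h)
  · rintro rfl
    exact hde (hΔ.eq_of_adj hne ((Δ.adj i).trans ((Δ.adj i).symm hi) hi') hj)
  · rintro rfl
    exact hcd (hΔ.eq_of_adj hne hi ((Δ.adj j).trans hj' ((Δ.adj j).symm hj)))

theorem IsLocallyRightAngled.isGallery_cons_append (hΔ : Δ.IsLocallyRightAngled M) {s : I}
    {u b : List I} (hu : ∀ t ∈ u, M s t = 2) {c e : C} (h : Δ.IsGallery c (u ++ s :: b) e) :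
    Δ.IsGallery c (s :: (u ++ b)) e := by
  induction u generalizing c with
  | nil => exact h
  | cons t u ih =>
    obtain ⟨ht, hu⟩ := List.forall_mem_cons.1 hu
    obtain _ | ⟨hadj, hne, h⟩ := h
    exact hΔ.isGallery_swap (by rwa [M.symmetric]) (.cons hadj hne (ih hu h))

theorem IsLocallyRightAngled.exists_isReduced_isGallery (hΔ : Δ.IsLocallyRightAngled M)
    (hM : M.IsRightAngled) {c e : C} (h : Δ.Reachable c e) :
    ∃ ω, M.toCoxeterSystem.IsReduced ω ∧ Δ.IsGallery c ω e := by
  induction h using Relation.ReflTransGen.head_induction_on with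
  | refl => exact ⟨[], by simp [CoxeterSystem.IsReduced], .nil e⟩
  | @head c d hadj _ ih =>
    obtain ⟨s, hcd⟩ := hadj
    obtain ⟨ω, hω, hg⟩ := ih
    by_cases hne : c = d
    · exact ⟨ω, hω, hne ▸ hg⟩
    by_cases hsω : M.toCoxeterSystem.IsReduced (s :: ω)
    · exact ⟨s :: ω, hsω, .cons hcd hne hg⟩
    obtain ⟨u, b, rfl, hu⟩ := isInitialLetter_of_not_isReduced_cons hM hω hsω
    have hsub : M.toCoxeterSystem.IsReduced (s :: (u ++ b)) := by
      unfold CoxeterSystem.IsReduced at hω ⊢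
      rw [← wordProd_append_cons_of_commute hu, hω]
      simp [add_assoc]
    obtain _ | @⟨_, d', _, _, _, hdd', -, hg'⟩ := hΔ.isGallery_cons_append hu hg
    have hcd' := (Δ.adj s).trans hcd hdd'
    by_cases hne' : c = d'
    · exact ⟨u ++ b, hsub.drop 1, hne' ▸ hg'⟩
    · exact ⟨s :: (u ++ b), hsub, .cons hcd' hne' hg'⟩

theorem IsBuilding.eq_nil_of_isGallery_self (hΔ : Δ.IsBuilding M) {ω : List I}
    (hω : M.toCoxeterSystem.IsReduced ω) {c : C} (h : Δ.IsGallery c ω c) : ω = [] := by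
  obtain ⟨-, -, δ, hδ⟩ := hΔ
  have hone : δ c c = 1 := (hδ c c [] (by simp [CoxeterSystem.IsReduced])).2 (.nil c)
  have hlen := hω.eq
  rw [← (hδ c c ω hω).2 h, hone, CoxeterSystem.length_one] at hlen
  exact List.length_eq_zero_iff.1 hlen.symm

theorem IsBuilding.isLocallyRightAngled (hΔ : Δ.IsBuilding M) (hM : M.IsRightAngled) :
    Δ.IsLocallyRightAngled M where
  eq_of_adj := fun {i j c d} hij hi hj => by
    by_contra hcd
    have hg : Δ.IsGallery c [i, j] c :=
      .cons hi hcd (.cons ((Δ.adj j).symm hj) (Ne.symm hcd) (.nil c))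
    exact List.cons_ne_nil _ _ (hΔ.eq_nil_of_isGallery_self (isReduced_pair hM hij) hg)
  exists_square := fun {i j c d e} hij hcd hde => by
    rcases eq_or_ne c d with rfl | hne
    · exact ⟨e, hde, (Δ.adj i).refl e⟩
    rcases eq_or_ne d e with rfl | hne'
    · exact ⟨c, (Δ.adj j).refl c, hcd⟩
    obtain ⟨-, -, δ, hδ⟩ := hΔ
    have hij' : i ≠ j := ne_of_eq_two hij
    have hprod : M.toCoxeterSystem.wordProd [i, j] = M.toCoxeterSystem.wordProd [j, i] :=
      (wordProd_append_cons_of_commute (u := [j]) (by simpa) []).symm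
    have hδce := (hδ c e [i, j] (isReduced_pair hM hij')).2
      (.cons hcd hne (.cons hde hne' (.nil e)))
    rw [hprod] at hδce
    obtain _ | ⟨hj, -, _ | ⟨hi, -, _ | _⟩⟩ := (hδ c e [j, i] (isReduced_pair hM hij'.symm)).1 hδce
    exact ⟨_, hj, hi⟩

theorem IsBuilding.reachable (hΔ : Δ.IsBuilding M) (c d : C) : Δ.Reachable c d := by
  obtain ⟨-, -, δ, hδ⟩ := hΔ
  obtain ⟨ω, hω, heq⟩ := M.toCoxeterSystem.exists_isReduced (δ c d)
  exact ((hδ c d ω hω).1 heq).reachable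

/-- `p` is a covering of `Δ` by `E` if it maps every panel of `E` bijectively onto a panel of
`Δ` of the same type. -/
def IsCovering (E : ChamberSystem I D) (Δ : ChamberSystem I C) (p : D → C) : Prop :=
  ∀ i e, Set.BijOn p (E.panel i e) (Δ.panel i (p e))

theorem IsCovering.isGallery_map {p : D → C} (hp : IsCovering E Δ p) {d e : D} {ω : List I}
    (h : E.IsGallery d ω e) : Δ.IsGallery (p d) ω (p e) := by
  induction h with
  | nil => exact .nil _
  | @cons d d' e i ω hadj hne _ ih =>
    refine .cons ((hp i d).mapsTo hadj) (fun heq => hne ?_) ih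
    exact (hp i d).injOn ((E.adj i).refl d) hadj heq

/-- A covering is injective on components, because a gallery of reduced type upstairs has a
gallery of the same type as its image, which cannot be closed. -/
theorem IsCovering.eq_of_reachable {p : D → C} (hp : IsCovering E Δ p)
    (hE : E.IsLocallyRightAngled M) (hΔ : Δ.IsBuilding M) (hM : M.IsRightAngled) {d e : D}
    (h : E.Reachable d e) (hde : p d = p e) : d = e := by
  obtain ⟨ω, hω, hg⟩ := hE.exists_isReduced_isGallery hM h
  have hclosed := hp.isGallery_map hg
  rw [← hde] at hclosed
  obtain rfl := hΔ.eq_nil_of_isGallery_self hω hclosed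
  cases hg
  rfl

theorem IsCovering.exists_section {p : D → C} (hp : IsCovering E Δ p)
    (hE : E.IsLocallyRightAngled M) (hΔ : Δ.IsBuilding M) (hM : M.IsRightAngled) (e : D) :
    ∃ σ : C → D, σ (p e) = e ∧ (∀ c, p (σ c) = c) ∧
      ∀ i c d, (Δ.adj i) c d → (E.adj i) (σ c) (σ d) := by
  have hlift (c : C) : ∃ d, E.Reachable e d ∧ p d = c := by
    induction hΔ.reachable (p e) c with
    | refl => exact ⟨e, .refl, rfl⟩
    | tail _ hadj ih =>
      obtain ⟨i, hadj⟩ := hadj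
      obtain ⟨d, hed, rfl⟩ := ih
      obtain ⟨d', hdd', rfl⟩ := (hp i d).surjOn hadj
      exact ⟨d', .tail hed ⟨i, hdd'⟩, rfl⟩
  choose σ hσ hpσ using hlift
  have huniq {d d' : D} (hd : E.Reachable e d) (hd' : E.Reachable e d') (h : p d = p d') :
      d = d' :=
    hp.eq_of_reachable hE hΔ hM (hd.symm.trans hd') h
  refine ⟨σ, huniq (hσ _) .refl (hpσ _), hpσ, fun i c d hcd => ?_⟩
  obtain ⟨d', hadj, hd'⟩ := (hp i (σ c)).surjOn (show d ∈ Δ.panel i (p (σ c)) by rwa [hpσ])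
  have hed' : E.Reachable e d' := .tail (hσ c) ⟨i, hadj⟩
  rwa [huniq (hσ d) hed' ((hpσ d).trans hd'.symm)]

variable {Z : I → Type*} {κ : C → (i : I) → Z i} {μ : Y → (i : I) → Z i}

/-- `κ` colours the chambers in such a way that `i`-adjacent chambers differ at most in their
`i`-th colour. -/
def IsColouring (Δ : ChamberSystem I C) (κ : C → (i : I) → Z i) : Prop :=
  ∀ ⦃i c d⦄, (Δ.adj i) c d → ∀ j ≠ i, κ d j = κ c j

/-- The fibre product of two chamber systems over colourings `κ` and `μ` with the same
colours. -/
def fiberProduct (Δ : ChamberSystem I C) (Λ : ChamberSystem I Y) (κ : C → (i : I) → Z i)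
    (μ : Y → (i : I) → Z i) : ChamberSystem I {q : C × Y // κ q.1 = μ q.2} where
  adj i := (Δ.adj i).comap (fun q => q.1.1) ⊓ (Λ.adj i).comap (fun q => q.1.2)

theorem isLocallyRightAngled_fiberProduct (hΔ : Δ.IsLocallyRightAngled M)
    (hΛ : Λ.IsLocallyRightAngled M) (hκ : Δ.IsColouring κ) (hμ : Λ.IsColouring μ) :
    (fiberProduct Δ Λ κ μ).IsLocallyRightAngled M where
  eq_of_adj := fun hij hi hj =>
    Subtype.ext (Prod.ext (hΔ.eq_of_adj hij hi.1 hj.1) (hΛ.eq_of_adj hij hi.2 hj.2))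
  exists_square := fun {i j c d e} hij hcd hde => by
    obtain ⟨x, hcx, hxe⟩ := hΔ.exists_square hij hcd.1 hde.1
    obtain ⟨y, hcy, hye⟩ := hΛ.exists_square hij hcd.2 hde.2
    refine ⟨⟨(x, y), funext fun k => ?_⟩, ⟨hcx, hcy⟩, ⟨hxe, hye⟩⟩
    rcases eq_or_ne k j with rfl | hkj
    · have hki : k ≠ i := (ne_of_eq_two hij).symm
      exact (hκ hxe k hki).symm.trans ((congrFun e.2 k).trans (hμ hye k hki))
    · exact (hκ hcx k hkj).trans ((congrFun c.2 k).trans (hμ hcy k hkj).symm)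

theorem isCovering_fiberProduct (hκ : Δ.IsColouring κ) (hμ : Λ.IsColouring μ)
    (hinj : ∀ i y y', (Λ.adj i) y y' → μ y i = μ y' i → y = y')
    (hlift : ∀ i y c, ∃ y', (Λ.adj i) y y' ∧ μ y' i = κ c i) :
    IsCovering (fiberProduct Δ Λ κ μ) Δ fun q => q.1.1 := by
  refine fun i q => ⟨fun r hr => hr.1, fun r hr s hs hrs => ?_, fun d hd => ?_⟩
  · have hadj : (Λ.adj i) r.1.2 s.1.2 := (Λ.adj i).trans ((Λ.adj i).symm hr.2) hs.2
    refine Subtype.ext (Prod.ext hrs (hinj i _ _ hadj ?_))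
    rw [← r.2, ← s.2]
    exact congrArg (κ · i) hrs
  · obtain ⟨y, hadj, hy⟩ := hlift i q.1.2 d
    refine ⟨⟨(d, y), funext fun k => ?_⟩, ⟨hd, hadj⟩, rfl⟩
    rcases eq_or_ne k i with rfl | hki
    · exact hy.symm
    · exact (hκ hd k hki).trans ((congrFun q.2 k).trans (hμ hadj k hki).symm)

/-- The morphism is a section of the fibre product, which covers the building. -/
theorem IsBuilding.exists_morphism (hΔ : Δ.IsBuilding M) (hM : M.IsRightAngled)
    (hΛ : Λ.IsLocallyRightAngled M) (hκ : Δ.IsColouring κ) (hμ : Λ.IsColouring μ)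
    (hinj : ∀ i y y', (Λ.adj i) y y' → μ y i = μ y' i → y = y')
    (hlift : ∀ i y c, ∃ y', (Λ.adj i) y y' ∧ μ y' i = κ c i) {c : C} {y : Y} (hcy : κ c = μ y) :
    ∃ Φ : C → Y, Φ c = y ∧ (∀ d, μ (Φ d) = κ d) ∧
      ∀ i d e, (Δ.adj i) d e → (Λ.adj i) (Φ d) (Φ e) := by
  obtain ⟨σ, hσc, hσ, hadj⟩ := (isCovering_fiberProduct hκ hμ hinj hlift).exists_section
    (isLocallyRightAngled_fiberProduct (hΔ.isLocallyRightAngled hM) hΛ hκ hμ) hΔ hM ⟨(c, y), hcy⟩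
  refine ⟨fun d => (σ d).1.2, congrArg (fun q => q.1.2) hσc, fun d => ?_,
    fun i d e hde => (hadj i d e hde).2⟩
  rw [← (σ d).2, hσ]

end Covering

/-! ### Automorphisms with prescribed colours -/

section Colourings

variable {I C D : Type*} {X : I → Type*} {M : CoxeterMatrix I} {Δ : ChamberSystem I C}

namespace LegalColouring

theorem isColouring (lam : Δ.LegalColouring X) : Δ.IsColouring lam.colour :=
  fun i c d hcd j hj => lam.constant i j hj c d hcd

theorem exists_adj_colour_eq (lam : Δ.LegalColouring X) (i : I) (c : C) (x : X i) :
    ∃ d, (Δ.adj i) c d ∧ lam.colour d i = x := by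
  obtain ⟨⟨d, hd⟩, hx⟩ := (lam.bijective i c).2 x
  exact ⟨d, hd, hx⟩

theorem eq_of_adj (lam : Δ.LegalColouring X) {i : I} {c d e : C} (hd : (Δ.adj i) c d)
    (he : (Δ.adj i) c e) (hcol : lam.colour d i = lam.colour e i) : d = e :=
  congrArg Subtype.val <| (lam.bijective i c).1 (a₁ := ⟨d, hd⟩) (a₂ := ⟨e, he⟩) hcol

theorem eq_of_reachable (lam : Δ.LegalColouring X) {E : ChamberSystem I D} {φ ψ : D → C}
    (hφ : ∀ i d e, (E.adj i) d e → (Δ.adj i) (φ d) (φ e))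
    (hψ : ∀ i d e, (E.adj i) d e → (Δ.adj i) (ψ d) (ψ e))
    (hcol : ∀ d, lam.colour (φ d) = lam.colour (ψ d)) {d e : D} (hde : E.Reachable d e)
    (hd : φ d = ψ d) : φ e = ψ e := by
  induction hde with
  | refl => exact hd
  | tail _ hadj ih =>
    obtain ⟨i, hadj⟩ := hadj
    exact lam.eq_of_adj (ih ▸ hφ i _ _ hadj) (hψ i _ _ hadj) (congrFun (hcol _) i)

theorem exists_endomorphism (hΔ : Δ.IsBuilding M) (hM : M.IsRightAngled)
    (lam lam' : Δ.LegalColouring X) {c : C} (hc : lam'.colour c = lam.colour c) :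
    ∃ Φ : C → C, Φ c = c ∧ (∀ d, lam.colour (Φ d) = lam'.colour d) ∧
      ∀ i d e, (Δ.adj i) d e → (Δ.adj i) (Φ d) (Φ e) :=
  hΔ.exists_morphism hM (hΔ.isLocallyRightAngled hM) lam'.isColouring lam.isColouring
    (fun i d _ => lam.eq_of_adj ((Δ.adj i).refl d))
    (fun i d e => lam.exists_adj_colour_eq i d (lam'.colour e i)) hc

theorem exists_aut (hΔ : Δ.IsBuilding M) (hM : M.IsRightAngled)
    (lam lam' : Δ.LegalColouring X) {c : C} (hc : lam'.colour c = lam.colour c) :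
    ∃ g : Δ.Aut, g.1 c = c ∧ ∀ d, lam.colour (g.1 d) = lam'.colour d := by
  obtain ⟨Φ, hΦc, hΦ, hΦadj⟩ := exists_endomorphism hΔ hM lam lam' hc
  obtain ⟨Ψ, hΨc, hΨ, hΨadj⟩ := exists_endomorphism hΔ hM lam' lam hc.symm
  have hΨΦ (d : C) : Ψ (Φ d) = d :=
    lam'.eq_of_reachable (ψ := id) (fun i d e h => hΨadj i _ _ (hΦadj i d e h))
      (fun _ _ _ => id) (fun d => (hΨ _).trans (hΦ d)) (hΔ.reachable c d)
      ((congrArg Ψ hΦc).trans hΨc)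
  have hΦΨ (d : C) : Φ (Ψ d) = d :=
    lam.eq_of_reachable (ψ := id) (fun i d e h => hΦadj i _ _ (hΨadj i d e h))
      (fun _ _ _ => id) (fun d => (hΦ _).trans (hΨ d)) (hΔ.reachable c d)
      ((congrArg Φ hΨc).trans hΦc)
  refine ⟨⟨⟨Φ, Ψ, hΨΦ, hΦΨ⟩, fun i d e => ⟨fun h => ?_, hΦadj i d e⟩⟩, hΦc, hΦ⟩
  rw [← hΨΦ d, ← hΨΦ e]
  exact hΨadj i _ _ h

end LegalColouring

variable {lam : Δ.LegalColouring X} {F : (i : I) → Subgroup (Equiv.Perm (X i))}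

theorem exists_mem_universalGroup (hΔ : Δ.IsBuilding M) (hM : M.IsRightAngled)
    {κ : C → (i : I) → X i} (hκ : Δ.IsColouring κ)
    (hlocal : ∀ i c, ∃ f ∈ F i, ∀ d ∈ Δ.panel i c, κ d i = f (lam.colour d i)) {a : C}
    (ha : κ a = lam.colour a) :
    ∃ g ∈ universalGroup lam F, g.1 a = a ∧ ∀ d, lam.colour (g.1 d) = κ d := by
  let lam' : Δ.LegalColouring X :=
    { colour := κ
      bijective := fun i c => by
        obtain ⟨f, -, hf⟩ := hlocal i c
        convert f.bijective.comp (lam.bijective i c) using 2 with d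
        exact hf d d.2
      constant := fun i j hj c d hd => hκ hd j hj }
  obtain ⟨g, hga, hg⟩ := LegalColouring.exists_aut hΔ hM lam lam' ha
  refine ⟨g, fun i c => ?_, hga, hg⟩
  obtain ⟨f, hfF, hf⟩ := hlocal i c
  rw [lam.localAction_eq_of_colour g i c f fun d hd => ?_]
  · exact hfF
  · rw [hg d, ← hf d hd]

open Classical in
/-- The colouring that arises from `lam` by applying the permutation `f` to the `i`-colours of
the chambers outside `V`. -/
noncomputable def twistedColour (lam : Δ.LegalColouring X) {i : I} (f : Equiv.Perm (X i))
    (V : Set C) (d : C) : (k : I) → X k :=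
  Function.update (lam.colour d) i (if d ∈ V then lam.colour d i else f (lam.colour d i))

section Twist

variable {i : I} {f : Equiv.Perm (X i)} {V : Set C}

theorem twistedColour_of_mem {d : C} (hd : d ∈ V) : twistedColour lam f V d = lam.colour d := by
  simp [twistedColour, hd]

theorem twistedColour_of_ne {k : I} (hk : k ≠ i) (d : C) :
    twistedColour lam f V d k = lam.colour d k := by
  simp [twistedColour, hk]

theorem twistedColour_of_notMem {d : C} (hd : d ∉ V) :
    twistedColour lam f V d i = f (lam.colour d i) := by
  simp [twistedColour, hd]

theorem isColouring_twistedColour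
    (hV : ∀ k ≠ i, ∀ d e, (Δ.adj k) d e → (d ∈ V ↔ e ∈ V)) :
    Δ.IsColouring (twistedColour lam f V) := by
  intro k c d hcd j hj
  rcases eq_or_ne j i with rfl | hji
  · by_cases hc : c ∈ V
    · have hd : d ∈ V := (hV k hj.symm c d hcd).1 hc
      rw [twistedColour_of_mem hc, twistedColour_of_mem hd, lam.isColouring hcd j hj]
    · have hd : d ∉ V := mt (hV k hj.symm c d hcd).2 hc
      rw [twistedColour_of_notMem hc, twistedColour_of_notMem hd, lam.isColouring hcd j hj]
  · rw [twistedColour_of_ne hji, twistedColour_of_ne hji, lam.isColouring hcd j hj]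

/-- This includes the chambers of the panel that lie in `V`: their colour `x` is fixed by `f`. -/
theorem twistedColour_of_panel {x : X i} (hfx : f x = x)
    (hVi : ∀ d e, (Δ.adj i) d e → d ∈ V → e ∉ V → lam.colour d i = x) {c d : C} (hc : c ∉ V)
    (hcd : (Δ.adj i) c d) : twistedColour lam f V d i = f (lam.colour d i) := by
  by_cases hd : d ∈ V
  · rw [twistedColour_of_mem hd, hVi d c ((Δ.adj i).symm hcd) hd hc, hfx]
  · exact twistedColour_of_notMem hd

theorem exists_mem_universalGroup_localAction_eq (hΔ : Δ.IsBuilding M) (hM : M.IsRightAngled)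
    {x : X i} (hfF : f ∈ F i) (hfx : f x = x)
    (hV : ∀ k ≠ i, ∀ d e, (Δ.adj k) d e → (d ∈ V ↔ e ∈ V))
    (hVi : ∀ d e, (Δ.adj i) d e → d ∈ V → e ∉ V → lam.colour d i = x) {a : C}
    (ha : lam.colour a i = x) :
    ∃ g ∈ universalGroup lam F, g.1 a = a ∧ (∀ d ∈ V, lam.colour (g.1 d) = lam.colour d) ∧
      ∀ c ∉ V, lam.localAction g i c = f := by
  have hlocal (k : I) (c : C) :
      ∃ s ∈ F k, ∀ d ∈ Δ.panel k c, twistedColour lam f V d k = s (lam.colour d k) := by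
    rcases eq_or_ne k i with rfl | hk
    · by_cases hc : ∀ d ∈ Δ.panel k c, d ∈ V
      · exact ⟨1, (F k).one_mem, fun d hd => congrFun (twistedColour_of_mem (hc d hd)) k⟩
      push Not at hc
      obtain ⟨e, he, heV⟩ := hc
      exact ⟨f, hfF, fun d hd => twistedColour_of_panel hfx hVi heV
        ((Δ.adj k).trans ((Δ.adj k).symm he) hd)⟩
    · exact ⟨1, (F k).one_mem, fun d _ => twistedColour_of_ne hk d⟩
  have haa : twistedColour lam f V a = lam.colour a := by
    funext k
    rcases eq_or_ne k i with rfl | hk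
    · by_cases haV : a ∈ V
      · rw [twistedColour_of_mem haV]
      · rw [twistedColour_of_notMem haV, ha, hfx]
    · exact twistedColour_of_ne hk a
  obtain ⟨g, hgU, hga, hg⟩ :=
    exists_mem_universalGroup hΔ hM (isColouring_twistedColour hV) hlocal haa
  refine ⟨g, hgU, hga, fun d hd => (hg d).trans (twistedColour_of_mem hd), fun c hc => ?_⟩
  refine lam.localAction_eq_of_colour g i c f fun d hd => ?_
  rw [hg d, twistedColour_of_panel hfx hVi hc hd]

end Twist

end Colourings

/-! ### Heights -/

section Height

open Filter

variable {I C : Type*} {X : I → Type*} {M : CoxeterMatrix I} {Δ : ChamberSystem I C}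
  {lam : Δ.LegalColouring X} {i j : I}

/-- The thin building of infinite dihedral type `{i, j}`, as a chamber system over `I`: the
`i`-panels are the sets `{2m, 2m + 1}`, the `j`-panels are the sets `{2m - 1, 2m}`, and all other
panels are singletons. -/
def alternatingLine (i j : I) : ChamberSystem I ℤ where
  adj k :=
    { r := fun m n => (k ≠ i → (m + 1) / 2 = (n + 1) / 2) ∧ (k ≠ j → m / 2 = n / 2)
      iseqv := ⟨by grind, by grind, by grind⟩ }

/-- The colouring of the alternating line with two colours for the types `i` and `j`, and with a
single colour for every other type. -/
def lineColour (i j : I) (n : ℤ) (k : I) : Prop :=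
  (k = i → Even ((n + 1) / 2)) ∧ (k = j → Even (n / 2))

/-- The colouring which records whether the chamber `d` has the same colours as `a` for the types
`i` and `j`. -/
def agreementColour (lam : Δ.LegalColouring X) (i j : I) (a d : C) (k : I) : Prop :=
  k = i ∨ k = j → lam.colour d k = lam.colour a k

theorem eq_of_adj_alternatingLine {k : I} (hki : k ≠ i) (hkj : k ≠ j) {m n : ℤ}
    (hmn : ((alternatingLine i j).adj k) m n) : m = n := by
  have := hmn.1 hki
  have := hmn.2 hkj
  omega

theorem isLocallyRightAngled_alternatingLine (hij : M i j = 0) :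
    (alternatingLine i j).IsLocallyRightAngled M where
  eq_of_adj := fun {k l m n} hkl ⟨hk, hk'⟩ ⟨hl, hl'⟩ => by
    have hdiv : m / 2 = n / 2 := by grind
    have hdiv' : (m + 1) / 2 = (n + 1) / 2 := by grind
    lia
  exists_square := fun {k l m n r} hkl hk hl => by
    by_cases hk' : k ≠ i ∧ k ≠ j
    · obtain rfl := eq_of_adj_alternatingLine hk'.1 hk'.2 hk
      exact ⟨r, hl, ((alternatingLine i j).adj k).refl r⟩
    by_cases hl' : l ≠ i ∧ l ≠ j
    · obtain rfl := eq_of_adj_alternatingLine hl'.1 hl'.2 hl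
      exact ⟨m, ((alternatingLine i j).adj l).refl m, hk⟩
    -- Since `M k l = 2` and `M i j = 0`, the types `k` and `l` cannot both lie in `{i, j}`.
    grind [ne_of_eq_two, M.symmetric i j]

theorem isColouring_lineColour :
    (alternatingLine i j).IsColouring (lineColour i j) := by
  intro k m n hmn l hl
  refine propext (and_congr (forall_congr' fun hli => ?_) (forall_congr' fun hlj => ?_))
  · rw [hmn.1 (hli ▸ hl.symm)]
  · rw [hmn.2 (hlj ▸ hl.symm)]

theorem lineColour_left (hij : i ≠ j) (n : ℤ) : lineColour i j n i ↔ Even ((n + 1) / 2) := by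
  simp [lineColour, hij]

theorem lineColour_right (hij : i ≠ j) (n : ℤ) : lineColour i j n j ↔ Even (n / 2) := by
  simp [lineColour, hij.symm]

theorem eq_of_lineColour_eq (hij : i ≠ j) {k : I} {m n : ℤ}
    (hmn : ((alternatingLine i j).adj k) m n) (hcol : lineColour i j m k = lineColour i j n k) :
    m = n := by
  rcases eq_or_ne k i with rfl | hki
  · rw [eq_iff_iff, lineColour_left hij, lineColour_left hij, Int.even_iff, Int.even_iff] at hcol
    have := hmn.2 hij
    omega
  rcases eq_or_ne k j with rfl | hkj
  · rw [eq_iff_iff, lineColour_right hij, lineColour_right hij, Int.even_iff, Int.even_iff] at hcol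
    have := hmn.1 hki
    omega
  exact eq_of_adj_alternatingLine hki hkj hmn

theorem exists_adj_lineColour_iff (hij : i ≠ j) (k : I) (n : ℤ) {p : Prop}
    (hp : k ≠ i → k ≠ j → p) :
    ∃ m, ((alternatingLine i j).adj k) n m ∧ (lineColour i j m k ↔ p) := by
  by_cases hn : lineColour i j n k ↔ p
  · exact ⟨n, ((alternatingLine i j).adj k).refl n, hn⟩
  rcases eq_or_ne k i with rfl | hki
  · refine ⟨4 * (n / 2) + 1 - n, ⟨fun h => absurd rfl h, fun _ => by lia⟩, ?_⟩
    rw [lineColour_left hij, Int.even_iff] at *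
    by_cases p <;> lia
  rcases eq_or_ne k j with rfl | hkj
  · refine ⟨4 * ((n + 1) / 2) - 1 - n, ⟨fun _ => by lia, fun h => absurd rfl h⟩, ?_⟩
    rw [lineColour_right hij, Int.even_iff] at *
    by_cases p <;> lia
  · exact absurd (iff_of_true ⟨fun h => absurd h hki, fun h => absurd h hkj⟩ (hp hki hkj)) hn

theorem isColouring_agreementColour (a : C) : Δ.IsColouring (agreementColour lam i j a) := by
  intro k d e hde l hl
  rw [agreementColour, agreementColour, lam.isColouring hde l hl]

theorem exists_fold (hΔ : Δ.IsBuilding M) (hM : M.IsRightAngled) (lam : Δ.LegalColouring X)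
    (hij : M i j = 0) (a : C) :
    ∃ Φ : C → ℤ, Φ a = 0 ∧ (∀ d, Even ((Φ d + 1) / 2) ↔ lam.colour d i = lam.colour a i) ∧
      (∀ d, Even (Φ d / 2) ↔ lam.colour d j = lam.colour a j) ∧
      ∀ k d e, (Δ.adj k) d e → ((alternatingLine i j).adj k) (Φ d) (Φ e) := by
  have hne : i ≠ j := ne_of_eq_zero hij
  obtain ⟨Φ, hΦa, hcol, hadj⟩ := hΔ.exists_morphism hM (c := a) (y := 0)
    (isLocallyRightAngled_alternatingLine hij) (isColouring_agreementColour (lam := lam) a)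
    isColouring_lineColour (fun _ _ _ => eq_of_lineColour_eq hne)
    (fun k n c => by
      obtain ⟨m, hnm, hm⟩ := exists_adj_lineColour_iff hne k n
        (p := agreementColour lam i j a c k) fun hki hkj hk => absurd hk (not_or.2 ⟨hki, hkj⟩)
      exact ⟨m, hnm, propext hm⟩)
    (by funext k; simp [agreementColour, lineColour])
  refine ⟨Φ, hΦa, fun d => ?_, fun d => ?_, hadj⟩
  · rw [← lineColour_left hne, hcol]
    simp [agreementColour]
  · rw [← lineColour_right hne, hcol]
    simp [agreementColour]

/-- A function `h` on the chambers is a height for the `i`-colour `x` if it changes at most on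
`i`-panels, where it varies by at most one, and if the chambers of `i`-colour `x` are those of even
height. -/
structure IsHeight (lam : Δ.LegalColouring X) {i : I} (x : X i) (h : C → ℤ) : Prop where
  eq_of_adj : ∀ {k : I} {d e : C}, k ≠ i → (Δ.adj k) d e → h d = h e
  le_add_one : ∀ {d e : C}, (Δ.adj i) d e → h e ≤ h d + 1
  even_iff : ∀ d, Even (h d) ↔ lam.colour d i = x
  exists_lt : ∀ N, ∃ d, N < h d

theorem exists_adj_colour_eq_iff_ne (hΔ : Δ.IsBuilding M) (lam : Δ.LegalColouring X) (k : I)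
    (d : C) (x : X k) :
    ∃ e, (Δ.adj k) d e ∧ (lam.colour e k = x ↔ lam.colour d k ≠ x) := by
  by_cases hd : lam.colour d k = x
  · obtain ⟨e, hde, hne⟩ := hΔ.2.1 k d
    refine ⟨e, hde, iff_of_false (fun he => hne ?_) (not_not.2 hd)⟩
    exact lam.eq_of_adj hde ((Δ.adj k).refl d) (he.trans hd.symm)
  · obtain ⟨e, hde, he⟩ := lam.exists_adj_colour_eq k d x
    exact ⟨e, hde, iff_of_true he hd⟩

theorem exists_isHeight (hΔ : Δ.IsBuilding M) (hM : M.IsRightAngled) (hij : M i j = 0) (a : C) :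
    ∃ h : C → ℤ, IsHeight lam (lam.colour a i) h := by
  have hne : i ≠ j := ne_of_eq_zero hij
  obtain ⟨Φ, hΦa, hi, hj, hadj⟩ := exists_fold hΔ hM lam hij a
  have hsucc (d : C) : ∃ e, Φ e = Φ d + 1 := by
    rcases Int.even_or_odd (Φ d) with hd | hd
    · obtain ⟨e, hde, he⟩ := exists_adj_colour_eq_iff_ne hΔ lam i d (lam.colour a i)
      have := (hadj i d e hde).2 hne
      simp only [← hi, ne_eq, Int.even_iff] at he hd
      exact ⟨e, by omega⟩
    · obtain ⟨e, hde, he⟩ := exists_adj_colour_eq_iff_ne hΔ lam j d (lam.colour a j)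
      have := (hadj j d e hde).1 hne.symm
      simp only [← hj, ne_eq, Int.even_iff, Int.odd_iff] at he hd
      exact ⟨e, by omega⟩
  have hsurj (n : ℕ) : ∃ d, Φ d = n := by
    induction n with
    | zero => exact ⟨a, hΦa⟩
    | succ n ih =>
      obtain ⟨d, hd⟩ := ih
      simpa [hd] using hsucc d
  refine ⟨fun d => (Φ d + 1) / 2, fun hk hde => (hadj _ _ _ hde).1 hk, fun hde => ?_, hi,
    fun N => ?_⟩
  · have := (hadj i _ _ hde).2 hne
    omega
  · obtain ⟨d, hd⟩ := hsurj (2 * N.toNat + 1)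
    exact ⟨d, by omega⟩

theorem eventually_forall_fixed (hΔ : Δ.IsBuilding M) (h : C → ℤ) (a s : C) :
    ∀ᶠ N in atTop, ∀ g : Δ.Aut, g.1 a = a →
      (∀ d, h d ≤ N → lam.colour (g.1 d) = lam.colour d) → g.1 s = s := by
  induction hΔ.reachable a s with
  | refl => exact .of_forall fun N g hga _ => hga
  | @tail s s' _ hadj ih =>
    obtain ⟨k, hadj⟩ := hadj
    filter_upwards [ih, eventually_ge_atTop (h s')] with N hN hs' g hga hg
    have hgs : g.1 s = s := hN g hga hg
    have hgadj := (g.2 k s s').2 hadj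
    rw [hgs] at hgadj
    exact lam.eq_of_adj hgadj hadj (congrFun (hg s' hs') k)

/-- The chamber `c` lies above a sublevel set of a height that contains galleries to all chambers
of `S`, so that twisting the colouring above this set does not move `S`. -/
theorem exists_forall_exists_fixing_localAction_eq (hΔ : Δ.IsBuilding M) (hM : M.IsRightAngled)
    (F : (i : I) → Subgroup (Equiv.Perm (X i))) (hij : M i j = 0) (x : X i) {S : Set C}
    (hS : S.Finite) :
    ∃ c, ∀ f ∈ F i, f x = x →
      ∃ g ∈ universalGroup lam F, (∀ s ∈ S, g.1 s = s) ∧ lam.localAction g i c = f := by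
  obtain ⟨a₀⟩ := hΔ.1
  obtain ⟨a, -, ha⟩ := lam.exists_adj_colour_eq i a₀ x
  obtain ⟨h, hh⟩ := exists_isHeight (lam := lam) hΔ hM hij a
  rw [ha] at hh
  obtain ⟨N₀, hN₀⟩ := eventually_atTop.1 <| (eventually_all_finite hS).2
    fun s _ => eventually_forall_fixed (lam := lam) hΔ h a s
  obtain ⟨N, hN, hNeven⟩ : ∃ N, N₀ ≤ N ∧ Even N :=
    ⟨2 * |N₀|, by linarith [le_abs_self N₀, abs_nonneg N₀], even_two_mul _⟩
  obtain ⟨c, hc⟩ := hh.exists_lt N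
  have hV (k : I) (hk : k ≠ i) (d e : C) (hde : (Δ.adj k) d e) : h d ≤ N ↔ h e ≤ N := by
    rw [hh.eq_of_adj hk hde]
  have hVi (d e : C) (hde : (Δ.adj i) d e) (hd : h d ≤ N) (he : ¬ h e ≤ N) :
      lam.colour d i = x := by
    have hstep := hh.le_add_one hde
    obtain rfl : h d = N := by omega
    exact (hh.even_iff d).1 hNeven
  refine ⟨c, fun f hfF hfx => ?_⟩
  obtain ⟨g, hgU, hga, hgV, hgi⟩ :=
    exists_mem_universalGroup_localAction_eq hΔ hM (V := {d | h d ≤ N}) hfF hfx hV hVi ha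
  exact ⟨g, hgU, fun s hs => hN₀ N hN s hs g hga hgV, hgi c (not_le.2 hc)⟩

end Height

/-! ### Compact stabilisers in the universal group -/

section Compactness

open MulAction Topology

variable {I C : Type*} {X : I → Type*} {M : CoxeterMatrix I} {Δ : ChamberSystem I C}
  {lam : Δ.LegalColouring X} {F : (i : I) → Subgroup (Equiv.Perm (X i))}

theorem isClosed_aut (Δ : ChamberSystem I C) : IsClosed (Δ.Aut : Set (Equiv.Perm C)) := by
  have hinter : (Δ.Aut : Set (Equiv.Perm C)) =
      ⋂ (k : I) (c : C) (d : C), {g | (Δ.adj k) (g c) (g d) ↔ (Δ.adj k) c d} := by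
    ext g
    simp only [Set.mem_iInter]
    rfl
  rw [hinter]
  exact isClosed_iInter fun k => isClosed_iInter fun c => isClosed_iInter fun d =>
    (permTopology_isClopen_setOf_apply₂ (fun c' d' => (Δ.adj k) c' d' ↔ (Δ.adj k) c d)
      c d).isClosed

theorem continuous_localAction (lam : Δ.LegalColouring X) (i : I) (c : C) :
    Continuous fun g : Δ.Aut => lam.localAction g i c := by
  refine permTopology_continuous fun x y => ?_
  obtain ⟨d, hcd, rfl⟩ := lam.exists_adj_colour_eq i c x
  simp only [lam.localAction_colour _ i c d hcd]
  exact ((permTopology_isClopen_setOf_apply₂ (fun e _ => lam.colour e i = y) d d).preimage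
    continuous_subtype_val).isOpen

theorem isClosed_universalGroup (lam : Δ.LegalColouring X)
    (hF : ∀ i, IsClosed (F i : Set (Equiv.Perm (X i)))) :
    IsClosed (universalGroup lam F : Set Δ.Aut) := by
  have hinter : (universalGroup lam F : Set Δ.Aut) =
      ⋂ (i : I) (c : C), (fun g : Δ.Aut => lam.localAction g i c) ⁻¹' F i := by
    ext g
    simp only [Set.mem_iInter]
    rfl
  rw [hinter]
  exact isClosed_iInter fun i => isClosed_iInter fun c =>
    (hF i).preimage (continuous_localAction lam i c)

theorem isInducing_toPermHom_universalGroup (lam : Δ.LegalColouring X)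
    (F : (i : I) → Subgroup (Equiv.Perm (X i))) :
    IsInducing (toPermHom (universalGroup lam F) C) :=
  IsInducing.subtypeVal.comp IsInducing.subtypeVal

theorem isClosedEmbedding_toPermHom_universalGroup (lam : Δ.LegalColouring X)
    (hF : ∀ i, IsClosed (F i : Set (Equiv.Perm (X i)))) :
    IsClosedEmbedding (toPermHom (universalGroup lam F) C) :=
  (isClosed_aut Δ).isClosedEmbedding_subtypeVal.comp
    (isClosed_universalGroup lam hF).isClosedEmbedding_subtypeVal

theorem isCompact_stabilizer_of_forall_exists_localAction_eq {K : Subgroup (universalGroup lam F)}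
    (hK : IsCompact (K : Set (universalGroup lam F))) {i : I} {x : X i} {c : C}
    (hc : ∀ f ∈ F i, f x = x → ∃ g ∈ K, lam.localAction g.1 i c = f) :
    IsCompact (stabilizer (F i) x : Set (F i)) := by
  have hcont : Continuous fun g : universalGroup lam F => lam.localAction g.1 i c :=
    (continuous_localAction lam i c).comp continuous_subtype_val
  have himage : Subtype.val '' (stabilizer (F i) x : Set (F i)) =
      (fun g : universalGroup lam F => lam.localAction g.1 i c) '' K ∩ {f | f x = x} := by
    ext f
    constructor
    · rintro ⟨f, hfx : f.1 x = x, rfl⟩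
      exact ⟨hc f f.2 hfx, hfx⟩
    · rintro ⟨⟨g, -, rfl⟩, hfx⟩
      exact ⟨⟨_, g.2 i c⟩, hfx, rfl⟩
  have hclosed : IsClosed {f : Equiv.Perm (X i) | f x = x} :=
    (permTopology_isClopen_setOf_apply₂ (fun y _ => y = x) x x).isClosed
  exact IsInducing.subtypeVal.isCompact_iff.2 (himage ▸ (hK.image hcont).inter_right hclosed)

theorem isCompact_stabilizer_of_isCompact_stabilizer_universalGroup (hΔ : Δ.IsBuilding M)
    (hM : M.IsRightAngled)
    (hU : ∀ c : C, IsCompact (stabilizer (universalGroup lam F) c : Set (universalGroup lam F)))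
    (i : I) (x : X i) : IsCompact (stabilizer (F i) x : Set (F i)) := by
  obtain ⟨a₀⟩ := hΔ.1
  obtain ⟨a, -, ha⟩ := lam.exists_adj_colour_eq i a₀ x
  refine isCompact_stabilizer_of_forall_exists_localAction_eq (hU a) (c := a)
    fun f hfF hfx => ?_
  obtain ⟨g, hgU, hga, -, hg⟩ := exists_mem_universalGroup_localAction_eq hΔ hM (V := ∅)
    hfF hfx (fun _ _ _ _ _ => Iff.rfl) (fun _ _ _ h => h.elim) ha
  exact ⟨⟨g, hgU⟩, hga, hg a (Set.notMem_empty a)⟩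

theorem isCompact_stabilizer_of_locallyCompactSpace_universalGroup (hΔ : Δ.IsBuilding M)
    (hM : M.IsRightAngled) (hdiag : M.NoIsolatedNodes)
    [LocallyCompactSpace (universalGroup lam F)] (i : I) (x : X i) :
    IsCompact (stabilizer (F i) x : Set (F i)) := by
  obtain ⟨j, hji, hij⟩ := hdiag i
  obtain ⟨S, hS, hcomp⟩ :=
    exists_finite_isCompact_fixingSubgroup (isInducing_toPermHom_universalGroup lam F)
  obtain ⟨c, hc⟩ := exists_forall_exists_fixing_localAction_eq (lam := lam) hΔ hM F
    ((hM i j hji.symm).resolve_left hij) x hS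
  refine isCompact_stabilizer_of_forall_exists_localAction_eq hcomp (c := c) fun f hfF hfx => ?_
  obtain ⟨g, hgU, hgS, hg⟩ := hc f hfF hfx
  exact ⟨⟨g, hgU⟩, (mem_fixingSubgroup_iff _).2 hgS, hg⟩

theorem finite_orbit_stabilizer_universalGroup_of_adj {i : I} {d e : C}
    (hcomp : IsCompact (stabilizer (F i) (lam.colour d i) : Set (F i))) (hde : (Δ.adj i) d e) :
    (orbit (stabilizer (universalGroup lam F) d) e).Finite := by
  have hfin := finite_orbit_of_isCompact (G := F i) continuous_subtype_val hcomp (lam.colour e i)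
  have hadj (g : stabilizer (universalGroup lam F) d) : (Δ.adj i) d (g • e) := by
    have hgde := (g.1.1.2 i d e).2 hde
    rwa [show g.1.1.1 d = d from g.2] at hgde
  refine Set.Finite.of_finite_image (f := fun e' => lam.colour e' i) (hfin.subset ?_) ?_
  · rintro _ ⟨_, ⟨g, rfl⟩, rfl⟩
    have hfix : lam.localAction g.1.1 i d (lam.colour d i) = lam.colour d i := by
      rw [lam.localAction_colour g.1.1 i d d ((Δ.adj i).refl d)]
      exact congrArg (lam.colour · i) g.2
    exact ⟨⟨⟨_, g.1.2 i d⟩, hfix⟩, lam.localAction_colour g.1.1 i d e hde⟩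
  · rintro _ ⟨g, rfl⟩ _ ⟨h, rfl⟩ hgh
    exact lam.eq_of_adj (hadj g) (hadj h) hgh

theorem isCompact_stabilizer_universalGroup (hΔ : Δ.IsBuilding M)
    (hloc : ∀ (i : I) (x : X i), IsCompact (stabilizer (F i) x : Set (F i))) (c : C) :
    IsCompact (stabilizer (universalGroup lam F) c : Set (universalGroup lam F)) := by
  have hF (i : I) : IsClosed (F i : Set (Equiv.Perm (X i))) :=
    isClosed_of_isCompact_stabilizer (hloc i (lam.colour c i))
  have hU := isClosedEmbedding_toPermHom_universalGroup lam hF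
  refine isCompact_of_finite_orbits hU (isClopen_stabilizer hU.continuous c).isClosed fun d => ?_
  induction hΔ.reachable c d with
  | refl =>
    refine (Set.finite_singleton c).subset ?_
    rintro _ ⟨g, rfl⟩
    exact g.2
  | tail _ hadj ih =>
    obtain ⟨i, hadj⟩ := hadj
    exact finite_orbit_stabilizer_trans ih
      (finite_orbit_stabilizer_universalGroup_of_adj (hloc i _) hadj)

theorem locallyCompactSpace_universalGroup (hΔ : Δ.IsBuilding M)
    (hU : ∀ c : C, IsCompact (stabilizer (universalGroup lam F) c : Set (universalGroup lam F))) :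
    LocallyCompactSpace (universalGroup lam F) := by
  obtain ⟨c⟩ := hΔ.1
  exact locallyCompactSpace_of_isCompact_stabilizer
    (isInducing_toPermHom_universalGroup lam F).continuous (hU c)

end Compactness

end ChamberSystem

theorem mainTheorem8_general {I : Type u} {C : Type v} {X : I → Type w}
    (M : CoxeterMatrix I) (hM : M.IsRightAngled)
    (Δ : ChamberSystem I C) (hΔ : Δ.IsBuilding M)
    (lam : Δ.LegalColouring X) (F : (i : I) → Subgroup (Equiv.Perm (X i))) :
    (M.NoIsolatedNodes →
      List.TFAE [
        ∀ (i : I) (x : X i), IsCompact (MulAction.stabilizer (F i) x : Set (F i)),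
        ∀ c : C, IsCompact (MulAction.stabilizer (ChamberSystem.universalGroup lam F) c :
          Set (ChamberSystem.universalGroup lam F)),
        LocallyCompactSpace (ChamberSystem.universalGroup lam F)]) ∧
    ((∀ (i : I) (x : X i), IsCompact (MulAction.stabilizer (F i) x : Set (F i))) ↔
      ∀ c : C, IsCompact (MulAction.stabilizer (ChamberSystem.universalGroup lam F) c :
        Set (ChamberSystem.universalGroup lam F))) ∧
    ((∀ c : C, IsCompact (MulAction.stabilizer (ChamberSystem.universalGroup lam F) c :
        Set (ChamberSystem.universalGroup lam F))) →
      LocallyCompactSpace (ChamberSystem.universalGroup lam F)) := by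
  have h_iff : (∀ (i : I) (x : X i), IsCompact (MulAction.stabilizer (F i) x : Set (F i))) ↔
      ∀ c : C, IsCompact (MulAction.stabilizer (ChamberSystem.universalGroup lam F) c :
        Set (ChamberSystem.universalGroup lam F)) :=
    ⟨ChamberSystem.isCompact_stabilizer_universalGroup hΔ,
      ChamberSystem.isCompact_stabilizer_of_isCompact_stabilizer_universalGroup hΔ hM⟩
  have h_lc := ChamberSystem.locallyCompactSpace_universalGroup (lam := lam) (F := F) hΔ
  refine ⟨fun hdiag => ?_, h_iff, h_lc⟩
  tfae_have 1 ↔ 2 := h_iff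
  tfae_have 2 → 3 := h_lc
  tfae_have 3 → 1 := fun _ =>
    ChamberSystem.isCompact_stabilizer_of_locallyCompactSpace_universalGroup
      (lam := lam) hΔ hM hdiag
  tfae_finish

theorem mainTheorem8 {I : Type u} [Finite I] {C : Type v} {X : I → Type w}
    (M : CoxeterMatrix I) (hM : M.IsRightAngled)
    (Δ : ChamberSystem I C) (hΔ : Δ.IsBuilding M) (hq : Δ.IsSemiregular X)
    (lam : Δ.LegalColouring X) (F : (i : I) → Subgroup (Equiv.Perm (X i)))
    (hF : ∀ i, IsClosed (F i : Set (Equiv.Perm (X i)))) :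
    (M.NoIsolatedNodes →
      List.TFAE [
        ∀ (i : I) (x : X i), IsCompact (MulAction.stabilizer (F i) x : Set (F i)),
        ∀ c : C, IsCompact (MulAction.stabilizer (ChamberSystem.universalGroup lam F) c :
          Set (ChamberSystem.universalGroup lam F)),
        LocallyCompactSpace (ChamberSystem.universalGroup lam F)]) ∧
    ((∀ (i : I) (x : X i), IsCompact (MulAction.stabilizer (F i) x : Set (F i))) ↔
      ∀ c : C, IsCompact (MulAction.stabilizer (ChamberSystem.universalGroup lam F) c :
        Set (ChamberSystem.universalGroup lam F))) ∧
    ((∀ c : C, IsCompact (MulAction.stabilizer (ChamberSystem.universalGroup lam F) c :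
        Set (ChamberSystem.universalGroup lam F))) →
      LocallyCompactSpace (ChamberSystem.universalGroup lam F)) :=
  mainTheorem8_general M hM Δ hΔ lam F
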